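/- Let $f:\mathbb{R}^n\to\mathbb{R}^n$ be locally Lipschitz, i.e. every point of $\mathbb{R}^n$ has a neighbourhood on which $f$ is Lipschitz. For $x\in\mathbb{R}^n$ let $$\partial f(x)=\operatorname{co}\Bigl\{\lim_{i\to\infty} Df(x_i)\;:\; x_i\to x,\ f \text{ is differentiable at each } x_i,\ \text{and the limit exists}\Bigr\}$$ be the Clarke generalized Jacobian of $f$ at $x$, where $\operatorname{co}$ denotes the convex hull. Assume that 1. for every $y\in\mathbb{R}^n$ the functional $\varphi_y(x)=\tfrac12\|f(x)-y\|^2$ is coercive, i.e. $\varphi_y(x)\to+\infty$ as $\|x\|\to\infty$; 2. for every $x\in\mathbb{R}^n$ the set $\partial f(x)$ is of maximal rank, i.e. every matrix in $\partial f(x)$ is nonsingular. Then $f$ is a homeomorphism of $\mathbb{R}^n$ onto $\mathbb{R}^n$, and $f^{-1}$ is locally Lipschitz. -/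

import Mathlib

open Filter Topology

/-- The limits of Jacobians `Df(uᵢ)` along sequences `uᵢ → x` of points of differentiability
of `f` (the B-subdifferential of `f` at `x`). -/
def limitingJacobian {n k : ℕ}
    (f : EuclideanSpace ℝ (Fin n) → EuclideanSpace ℝ (Fin k)) (x : EuclideanSpace ℝ (Fin n)) :
    Set (EuclideanSpace ℝ (Fin n) →L[ℝ] EuclideanSpace ℝ (Fin k)) :=
  {A | ∃ u : ℕ → EuclideanSpace ℝ (Fin n),
    (∀ i, DifferentiableAt ℝ f (u i)) ∧ Tendsto u atTop (𝓝 x) ∧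
      Tendsto (fun i => fderiv ℝ f (u i)) atTop (𝓝 A)}

/-- Clarke's generalized Jacobian `∂f(x)`: the convex hull of all limits of Jacobians of `f`
at points of differentiability converging to `x`. Matrices are regarded as linear maps. -/
def clarkeJacobian {n k : ℕ}
    (f : EuclideanSpace ℝ (Fin n) → EuclideanSpace ℝ (Fin k)) (x : EuclideanSpace ℝ (Fin n)) :
    Set (EuclideanSpace ℝ (Fin n) →L[ℝ] EuclideanSpace ℝ (Fin k)) :=
  convexHull ℝ (limitingJacobian f x)

/-- A set of square matrices is of maximal rank if all its members are nonsingular. -/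
def IsOfMaximalRank {n : ℕ}
    (S : Set (EuclideanSpace ℝ (Fin n) →L[ℝ] EuclideanSpace ℝ (Fin n))) : Prop :=
  ∀ A ∈ S, A.det ≠ 0

/-- A functional is coercive if `φ(x) → +∞` as `‖x‖ → ∞`. -/
def IsCoerciveFunctional {n : ℕ} (φ : EuclideanSpace ℝ (Fin n) → ℝ) : Prop :=
  Tendsto φ (comap (fun x => ‖x‖) atTop) atTop

/-! The map `f` is a proper local homeomorphism of a simply connected space, hence a one-sheeted
covering. Properness is coercivity. Locally, `∂f(x)` is compact and convex, so for a vector `v` the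
sets `{A v}` and `{Aᵀ v}` have a point `p` of least norm, nonzero when `v ≠ 0`, and all their points
have inner product at least `‖p‖²` with `p`. Integrating derivatives along segments turns this into
expansion `δ‖a - b‖ ≤ ‖f a - f b‖` near each point (`exists_mul_norm_sub_le`), and into descent of
`‖f · - y‖` wherever `f x ≠ y` (`eq_of_isLocalMin_norm_sub`). The first gives local injectivity and
the Lipschitz inverse, the second openness. -/

/-- In a finite-dimensional space, the convex hull of a compact set is compact. -/
theorem IsCompact.convexHull_of_finiteDimensional {E : Type*} [NormedAddCommGroup E]
    [NormedSpace ℝ E] [FiniteDimensional ℝ E] {K : Set E} (hK : IsCompact K) :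
    IsCompact (convexHull ℝ K) := by
  let T (m : ℕ) : Set E := (fun p : (Fin m → ℝ) × (Fin m → E) => ∑ i, p.1 i • p.2 i) ''
    (stdSimplex ℝ (Fin m) ×ˢ Set.univ.pi fun _ => K)
  have hT (m : ℕ) : IsCompact (T m) :=
    ((isCompact_stdSimplex ℝ (Fin m)).prod (isCompact_univ_pi fun _ => hK)).image (by fun_prop)
  have hEq : convexHull ℝ K = ⋃ m ∈ Finset.range (Module.finrank ℝ E + 2), T m := by
    apply Set.Subset.antisymm
    · intro x hx
      obtain ⟨ι, hι, z, w, hz, hind, hw, hw1, hsum⟩ := eq_pos_convex_span_of_mem_convexHull hx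
      -- Carathéodory: affinely independent points number at most `finrank + 1`, so finitely many
      -- compact sets `T m` suffice.
      have hcard : Fintype.card ι ≤ Module.finrank ℝ E + 1 :=
        hind.card_le_finrank_succ.trans (by gcongr; exact Submodule.finrank_le _)
      let e := Fintype.equivFin ι
      simp only [Set.mem_iUnion, Finset.mem_range, exists_prop]
      refine ⟨Fintype.card ι, by omega, (w ∘ e.symm, z ∘ e.symm),
        ⟨⟨fun i => (hw _).le, ?_⟩, fun i _ => hz ⟨_, rfl⟩⟩, ?_⟩
      · rw [← hw1]; exact e.symm.sum_comp w
      · rw [← hsum]; exact e.symm.sum_comp fun i => w i • z i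
    · simp only [Set.iUnion_subset_iff]
      rintro m - _ ⟨⟨w, z⟩, ⟨⟨hw0, hw1⟩, hz⟩, rfl⟩
      exact (convex_convexHull ℝ K).sum_mem (fun i _ => hw0 i) hw1
        fun i _ => subset_convexHull ℝ K (hz i trivial)
  rw [hEq]
  exact (Finset.range _).isCompact_biUnion fun m _ => hT m

/-- A nonempty compact convex set has a point `p` such that `⟪p, q⟫ ≥ ‖p‖ ^ 2` throughout. -/
theorem IsCompact.exists_norm_sq_le_inner {E : Type*} [NormedAddCommGroup E]
    [InnerProductSpace ℝ E] {K : Set E} (hK : IsCompact K) (hconv : Convex ℝ K)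
    (hne : K.Nonempty) : ∃ p ∈ K, ∀ q ∈ K, ‖p‖ ^ 2 ≤ inner ℝ p q := by
  obtain ⟨p, hp, hmin⟩ := exists_norm_eq_iInf_of_complete_convex hne hK.isComplete hconv 0
  refine ⟨p, hp, fun q hq => ?_⟩
  have h := (norm_eq_iInf_iff_real_inner_le_zero hconv hp).1 hmin q hq
  rw [zero_sub, inner_neg_left, inner_sub_right, real_inner_self_eq_norm_sq] at h
  linarith

open MeasureTheory in
/-- Mean value inequality for Lipschitz functions: it suffices to bound the derivative
at the points of differentiability. -/
theorem LipschitzOnWith.le_apply_sub_of_le_apply_fderiv {E F : Type*}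
    [NormedAddCommGroup E] [NormedSpace ℝ E] [FiniteDimensional ℝ E]
    [NormedAddCommGroup F] [NormedSpace ℝ F] [FiniteDimensional ℝ F]
    {f : E → F} {C : NNReal} {U : Set E} (hf : LipschitzOnWith C f U) (hU : IsOpen U)
    (hconv : Convex ℝ U) (l : F →L[ℝ] ℝ) (v : E) {c : ℝ}
    (hc : ∀ x ∈ U, DifferentiableAt ℝ f x → c ≤ l (fderiv ℝ f x v))
    {x : E} (hx : x ∈ U) (hxv : x + v ∈ U) : c ≤ l (f (x + v) - f x) := by
  borelize E
  obtain ⟨μ, hμ⟩ : ∃ μ : Measure E, μ.IsAddHaarMeasure := ⟨Measure.addHaar, inferInstance⟩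
  have hdiff : ∀ᵐ x ∂μ, x ∈ U → DifferentiableAt ℝ f x := by
    filter_upwards [hf.ae_differentiableWithinAt_of_mem (μ := μ)] with x hx hxU
    exact (hx hxU).differentiableAt (hU.mem_nhds hxU)
  have hmeas : MeasurableSet {x | x ∈ U → DifferentiableAt ℝ f x} :=
    hU.measurableSet.imp (measurableSet_of_differentiableAt ℝ f)
  -- Rademacher and Fubini: a given segment may miss the differentiability set, but almost every
  -- parallel translate meets it almost everywhere.
  have hlines : ∀ᵐ x ∂μ, ∀ᵐ t : ℝ, x + t • v ∈ U → DifferentiableAt ℝ f (x + t • v) := by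
    rw [Measure.ae_ae_comm]
    · refine ae_of_all _ fun t => ?_
      have hmp : MeasurePreserving (fun x => x + t • v) μ μ := measurePreserving_add_right μ _
      exact hmp.quasiMeasurePreserving.ae hdiff
    · exact hmeas.preimage (by fun_prop : Measurable fun p : E × ℝ => p.1 + p.2 • v)
  have hgood : ∀ z ∈ U, z + v ∈ U →
      (∀ᵐ t : ℝ, z + t • v ∈ U → DifferentiableAt ℝ f (z + t • v)) →
      c ≤ l (f (z + v) - f z) := by
    intro z hz hzv hae
    have hseg : ∀ t ∈ Set.Icc (0 : ℝ) 1, z + t • v ∈ U := fun t ht =>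
      hconv.add_smul_mem hz hzv ht
    let g : ℝ → ℝ := fun t => l (f (z + t • v))
    have hg : AbsolutelyContinuousOnInterval g 0 1 := by
      have h1 : LipschitzOnWith (C * ‖v‖₊) (fun t : ℝ => f (z + t • v)) (Set.uIcc 0 1) := by
        rw [Set.uIcc_of_le zero_le_one]
        refine hf.comp (g := f) (f := fun t : ℝ => z + t • v) ?_ hseg
        refine LipschitzWith.lipschitzOnWith (LipschitzWith.of_dist_le_mul fun a b => ?_)
        simp [dist_eq_norm, ← sub_smul, norm_smul, mul_comm]
      exact (l.lipschitz.comp_lipschitzOnWith h1).absolutelyContinuousOnInterval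
    have hd : ∀ᵐ t : ℝ, t ∈ Set.Icc (0 : ℝ) 1 → c ≤ deriv g t := by
      filter_upwards [hae] with t ht ht01
      have hD := ht (hseg t ht01)
      have hline : HasDerivAt (fun t : ℝ => z + t • v) v t := by
        simpa using ((hasDerivAt_id t).smul_const v).const_add z
      have hgd : HasDerivAt g (l (fderiv ℝ f (z + t • v) v)) t :=
        l.hasFDerivAt.comp_hasDerivAt t (hD.hasFDerivAt.comp_hasDerivAt t hline)
      rw [hgd.deriv]
      exact hc _ (hseg t ht01) hD
    have hint := intervalIntegral.integral_mono_ae_restrict (zero_le_one' ℝ)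
      (intervalIntegrable_const (c := c) (μ := volume)) hg.intervalIntegrable_deriv
      ((ae_restrict_iff' measurableSet_Icc).2 hd)
    rw [hg.integral_deriv_eq_sub] at hint
    simpa [g] using hint
  -- Good base points are dense and a strict failure is an open condition, so it would occur at a
  -- good one.
  by_contra! hlt
  have hcf := hf.continuousOn
  have hev : ∀ᶠ z in 𝓝 x, z ∈ U ∧ z + v ∈ U ∧ l (f (z + v) - f z) < c := by
    have hadd : Tendsto (fun z => z + v) (𝓝 x) (𝓝 (x + v)) :=
      (continuous_add_const v).tendsto x
    have hlim : Tendsto (fun z => l (f (z + v) - f z)) (𝓝 x) (𝓝 (l (f (x + v) - f x))) :=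
      (l.continuous.tendsto _).comp
        (((hcf.continuousAt (hU.mem_nhds hxv)).tendsto.comp hadd).sub
          (hcf.continuousAt (hU.mem_nhds hx)).tendsto)
    exact (hU.eventually_mem hx).and
      ((hadd.eventually (hU.eventually_mem hxv)).and (hlim.eventually_lt_const hlt))
  obtain ⟨z, ⟨h1, h2, h3⟩, h4⟩ := (hev.and_frequently
    (Measure.dense_of_ae hlines x |> mem_closure_iff_frequently.1)).exists
  exact absurd (hgood z h1 h2 h4) (not_le.2 h3)

/-! ### Compactness and semicontinuity of the generalized Jacobian -/

section LimitingJacobian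

variable {n k : ℕ} {f : EuclideanSpace ℝ (Fin n) → EuclideanSpace ℝ (Fin k)}

theorem mem_limitingJacobian_iff_mem_closure {x : EuclideanSpace ℝ (Fin n)}
    {A : EuclideanSpace ℝ (Fin n) →L[ℝ] EuclideanSpace ℝ (Fin k)} :
    A ∈ limitingJacobian f x ↔
      (x, A) ∈ closure ((fun u => (u, fderiv ℝ f u)) '' {u | DifferentiableAt ℝ f u}) := by
  rw [mem_closure_iff_seq_limit]
  constructor
  · rintro ⟨u, hu, hux, huA⟩
    exact ⟨fun i => (u i, fderiv ℝ f (u i)), fun i => ⟨u i, hu i, rfl⟩, hux.prodMk_nhds huA⟩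
  · rintro ⟨p, hp, hlim⟩
    choose u hu hup using hp
    obtain rfl : (fun i => (u i, fderiv ℝ f (u i))) = p := funext hup
    exact ⟨u, hu, (continuous_fst.tendsto _).comp hlim, (continuous_snd.tendsto _).comp hlim⟩

theorem isClosed_limitingJacobian (x : EuclideanSpace ℝ (Fin n)) :
    IsClosed (limitingJacobian f x) := by
  have : limitingJacobian f x = (fun A => (x, A)) ⁻¹'
      closure ((fun u => (u, fderiv ℝ f u)) '' {u | DifferentiableAt ℝ f u}) :=
    Set.ext fun _ => mem_limitingJacobian_iff_mem_closure
  rw [this]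
  exact isClosed_closure.preimage (by fun_prop)

theorem LocallyLipschitz.exists_eventually_norm_fderiv_le (hf : LocallyLipschitz f)
    (x : EuclideanSpace ℝ (Fin n)) : ∃ C : ℝ, ∀ᶠ u in 𝓝 x, ‖fderiv ℝ f u‖ ≤ C := by
  obtain ⟨C, s, hs, hC⟩ := hf x
  refine ⟨C, ?_⟩
  filter_upwards [eventually_mem_nhds_iff.2 hs] with u hu
  exact norm_fderiv_le_of_lipschitzOn ℝ hu hC

theorem LocallyLipschitz.isCompact_limitingJacobian (hf : LocallyLipschitz f)
    (x : EuclideanSpace ℝ (Fin n)) : IsCompact (limitingJacobian f x) := by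
  obtain ⟨C, hC⟩ := hf.exists_eventually_norm_fderiv_le x
  refine (isCompact_closedBall 0 C).of_isClosed_subset (isClosed_limitingJacobian x) ?_
  rintro A ⟨u, -, hux, huA⟩
  rw [mem_closedBall_zero_iff]
  exact le_of_tendsto huA.norm (hux.eventually hC)

/-- Upper semicontinuity of the limiting Jacobian. -/
theorem LocallyLipschitz.eventually_fderiv_mem (hf : LocallyLipschitz f)
    {x : EuclideanSpace ℝ (Fin n)}
    {V : Set (EuclideanSpace ℝ (Fin n) →L[ℝ] EuclideanSpace ℝ (Fin k))}
    (hV : IsOpen V) (hsub : limitingJacobian f x ⊆ V) :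
    ∀ᶠ u in 𝓝 x, DifferentiableAt ℝ f u → fderiv ℝ f u ∈ V := by
  by_contra hcon
  obtain ⟨C, hC⟩ := hf.exists_eventually_norm_fderiv_le x
  have hfreq := (not_eventually.1 hcon).and_eventually hC
  obtain ⟨u, hux, hu⟩ := exists_seq_forall_of_frequently hfreq
  simp only [Classical.not_imp] at hu
  obtain ⟨A, hA, φ, hφ, hlim⟩ := ((isCompact_closedBall
    (0 : EuclideanSpace ℝ (Fin n) →L[ℝ] EuclideanSpace ℝ (Fin k)) C).diff hV).tendsto_subseq
    (x := fun i => fderiv ℝ f (u i))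
    fun i => ⟨mem_closedBall_zero_iff.2 (hu i).2, (hu i).1.2⟩
  exact hA.2 (hsub ⟨u ∘ φ, fun i => (hu _).1.1, hux.comp hφ.tendsto_atTop, hlim⟩)

/-- Were it empty, semicontinuity with `V = ∅` would forbid differentiability near `x`, against
Rademacher. -/
theorem LocallyLipschitz.limitingJacobian_nonempty (hf : LocallyLipschitz f)
    (x : EuclideanSpace ℝ (Fin n)) : (limitingJacobian f x).Nonempty := by
  rw [Set.nonempty_iff_ne_empty]
  intro hempty
  have hnot := hf.eventually_fderiv_mem (x := x) isOpen_empty hempty.subset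
  obtain ⟨C, s, hs, hC⟩ := hf x
  have hev : ∀ᶠ u in 𝓝 x, s ∈ 𝓝 u ∧ ¬ DifferentiableAt ℝ f u :=
    (eventually_mem_nhds_iff.2 hs).and hnot
  obtain ⟨u, ⟨h1, h2⟩, h3⟩ := (hev.and_frequently (mem_closure_iff_frequently.1
    (MeasureTheory.Measure.dense_of_ae
      (hC.ae_differentiableWithinAt_of_mem (μ := MeasureTheory.volume)) x))).exists
  exact h2 ((h3 (mem_of_mem_nhds h1)).differentiableAt h1)

theorem LocallyLipschitz.isCompact_clarkeJacobian (hf : LocallyLipschitz f)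
    (x : EuclideanSpace ℝ (Fin n)) : IsCompact (clarkeJacobian f x) :=
  (hf.isCompact_limitingJacobian x).convexHull_of_finiteDimensional

theorem LocallyLipschitz.clarkeJacobian_nonempty (hf : LocallyLipschitz f)
    (x : EuclideanSpace ℝ (Fin n)) : (clarkeJacobian f x).Nonempty :=
  (hf.limitingJacobian_nonempty x).convexHull

end LimitingJacobian

/-! ### Local expansion and descent -/

section MaximalRank

variable {n : ℕ} {f : EuclideanSpace ℝ (Fin n) → EuclideanSpace ℝ (Fin n)}

theorem ContinuousLinearMap.injective_of_det_ne_zero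
    {A : EuclideanSpace ℝ (Fin n) →L[ℝ] EuclideanSpace ℝ (Fin n)} (hA : A.det ≠ 0) :
    Function.Injective A :=
  (LinearMap.equivOfDetNeZero (A : EuclideanSpace ℝ (Fin n) →ₗ[ℝ] EuclideanSpace ℝ (Fin n))
    hA).injective

theorem ContinuousLinearMap.surjective_of_det_ne_zero
    {A : EuclideanSpace ℝ (Fin n) →L[ℝ] EuclideanSpace ℝ (Fin n)} (hA : A.det ≠ 0) :
    Function.Surjective A :=
  (LinearMap.equivOfDetNeZero (A : EuclideanSpace ℝ (Fin n) →ₗ[ℝ] EuclideanSpace ℝ (Fin n))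
    hA).surjective

/-- A compact set of nonsingular matrices is uniformly bounded below. -/
theorem IsOfMaximalRank.exists_forall_mul_norm_le
    {S : Set (EuclideanSpace ℝ (Fin n) →L[ℝ] EuclideanSpace ℝ (Fin n))}
    (hS : IsOfMaximalRank S) (hK : IsCompact S) :
    ∃ δ > 0, ∀ A ∈ S, ∀ v, δ * ‖v‖ ≤ ‖A v‖ := by
  obtain ⟨δ, hδ, h⟩ := (hK.prod (isCompact_sphere (0 : EuclideanSpace ℝ (Fin n)) 1)).exists_forall_le'
    (f := fun p => ‖p.1 p.2‖) (a := 0) (by fun_prop) (by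
      rintro ⟨A, v⟩ ⟨hA, hv⟩
      refine norm_pos_iff.2 fun h0 => ?_
      have : v = 0 := ContinuousLinearMap.injective_of_det_ne_zero (hS A hA)
        (h0.trans (map_zero A).symm)
      simp [this] at hv)
  refine ⟨δ, hδ, fun A hA v => ?_⟩
  rcases eq_or_ne v 0 with rfl | hv
  · simp
  · have := h (A, ‖v‖⁻¹ • v) ⟨hA, by simp [norm_smul, hv]⟩
    simp only [map_smul, norm_smul, norm_inv, norm_norm] at this
    have hv' := norm_pos_iff.2 hv
    rwa [inv_mul_eq_div, le_div_iff₀ hv'] at this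

/-- A locally Lipschitz map with nonsingular generalized Jacobian at `x` is expanding near `x`. -/
theorem LocallyLipschitz.exists_mul_norm_sub_le (hf : LocallyLipschitz f)
    {x : EuclideanSpace ℝ (Fin n)} (hrank : IsOfMaximalRank (clarkeJacobian f x)) :
    ∃ δ > 0, ∃ r > 0, ∀ a ∈ Metric.ball x r, ∀ b ∈ Metric.ball x r,
      δ * ‖a - b‖ ≤ ‖f a - f b‖ := by
  obtain ⟨δ, hδ, hlow⟩ := hrank.exists_forall_mul_norm_le (hf.isCompact_clarkeJacobian x)
  obtain ⟨C, s, hs, hC⟩ := hf x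
  have hnear := hf.eventually_fderiv_mem (x := x)
    (Metric.isOpen_thickening (δ := δ / 2) (E := clarkeJacobian f x))
    ((subset_convexHull ℝ _).trans (Metric.self_subset_thickening (half_pos hδ) _))
  obtain ⟨r, hr, hball⟩ := Metric.eventually_nhds_iff_ball.1 (hnear.and hs)
  refine ⟨δ / 2, half_pos hδ, r, hr, fun a ha b hb => ?_⟩
  rcases eq_or_ne a b with rfl | hab
  · simp
  let v := a - b
  have hv : 0 < ‖v‖ := norm_pos_iff.2 (sub_ne_zero.2 hab)
  obtain ⟨p, hp, hpq⟩ := ((hf.isCompact_clarkeJacobian x).image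
    (f := fun A => A v) (by fun_prop)).exists_norm_sq_le_inner
    ((convex_convexHull ℝ _).is_linear_image ⟨fun _ _ => rfl, fun _ _ => rfl⟩)
    ((hf.clarkeJacobian_nonempty x).image _)
  obtain ⟨A₀, hA₀, hA₀p⟩ := hp
  have hpn : δ * ‖v‖ ≤ ‖p‖ := hA₀p ▸ hlow A₀ hA₀ v
  have hp0 : 0 < ‖p‖ := (mul_pos hδ hv).trans_le hpn
  -- Nearby derivatives are within `δ / 2` of `∂f(x)`, and `‖p‖ ≥ δ‖v‖`, so half of `‖p‖²` survives
  -- the error.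
  have hmv := (hC.mono fun u hu => (hball u hu).2).le_apply_sub_of_le_apply_fderiv
    Metric.isOpen_ball (convex_ball x r) (innerSL ℝ p) v (c := ‖p‖ * (δ / 2 * ‖v‖))
    (fun u hu hud => by
      obtain ⟨A, hA, hdist⟩ := Metric.mem_thickening_iff.1 ((hball u hu).1 hud)
      have h1 := hpq _ ⟨A, hA, rfl⟩
      have h2 : inner ℝ p ((A - fderiv ℝ f u) v) ≤ ‖p‖ * (δ / 2 * ‖v‖) := by
        refine (real_inner_le_norm _ _).trans ?_
        gcongr
        refine (ContinuousLinearMap.le_opNorm _ _).trans ?_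
        gcongr
        rw [← dist_eq_norm, dist_comm]
        exact hdist.le
      rw [sub_apply, inner_sub_right] at h2
      rw [innerSL_apply_apply]
      nlinarith)
    hb (by simpa [v] using ha)
  rw [innerSL_apply_apply, show b + v = a by simp [v]] at hmv
  exact le_of_mul_le_mul_left (hmv.trans (real_inner_le_norm _ _)) hp0

/-- A local minimizer of `‖f · - y‖` at which the generalized Jacobian is nonsingular
solves `f x = y`. -/
theorem LocallyLipschitz.eq_of_isLocalMin_norm_sub (hf : LocallyLipschitz f)
    {x y : EuclideanSpace ℝ (Fin n)} (hrank : IsOfMaximalRank (clarkeJacobian f x))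
    (hmin : IsLocalMin (fun z => ‖f z - y‖) x) : f x = y := by
  by_contra hne
  let u := f x - y
  have hu : u ≠ 0 := sub_ne_zero.2 hne
  obtain ⟨p, hp, hpq⟩ := ((hf.isCompact_clarkeJacobian x).image
    (f := fun A => A.adjoint u) (by fun_prop)).exists_norm_sq_le_inner
    ((convex_convexHull ℝ _).is_linear_image
      ⟨fun _ _ => by simp, fun c A => by simp⟩)
    ((hf.clarkeJacobian_nonempty x).image _)
  have hp0 : 0 < ‖p‖ ^ 2 := by
    obtain ⟨A, hA, rfl⟩ := hp
    refine pow_pos (norm_pos_iff.2 fun h0 => hu ?_) 2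
    obtain ⟨z, hz⟩ := ContinuousLinearMap.surjective_of_det_ne_zero (hrank A hA) u
    rw [← inner_self_eq_zero (𝕜 := ℝ)]
    nth_rewrite 2 [← hz]
    rw [← ContinuousLinearMap.adjoint_inner_left]
    simp only at h0
    rw [h0, inner_zero_left]
  set c := ‖p‖ ^ 2 / 2 with hc
  have hc0 : 0 < c := half_pos hp0
  have hnear := hf.eventually_fderiv_mem (x := x) (V := {A | c < inner ℝ u (A p)})
    (isOpen_lt continuous_const (by fun_prop)) (fun A hA => by
      have := hpq _ ⟨A, subset_convexHull ℝ _ hA, rfl⟩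
      simp only [Set.mem_ofPred_eq] at this ⊢
      rw [real_inner_comm, ContinuousLinearMap.adjoint_inner_left] at this
      linarith)
  obtain ⟨C, s, hs, hC⟩ := hf x
  obtain ⟨r, hr, hball⟩ := Metric.eventually_nhds_iff_ball.1 (hnear.and hs)
  have hCr := hC.mono fun u hu => (hball u hu).2
  have hlim : Tendsto (fun t : ℝ => x - t • p) (𝓝[>] 0) (𝓝 x) := by
    have : Continuous fun t : ℝ => x - t • p := by fun_prop
    simpa using (this.tendsto 0).mono_left nhdsWithin_le_nhds
  -- Moving by `-t • p` gains at least `2tc` in the squared norm and costs at most `(C‖p‖t)²`; small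
  -- `t` makes the gain win.
  have hsmall : ∀ᶠ t : ℝ in 𝓝[>] 0, (C * ‖p‖) ^ 2 * t < 2 * c := by
    have : Continuous fun t : ℝ => (C * ‖p‖) ^ 2 * t := by fun_prop
    refine ((this.tendsto 0).mono_left nhdsWithin_le_nhds).eventually_lt_const ?_
    simpa using hc0
  obtain ⟨t, ⟨⟨hle, hb⟩, ht⟩, ht0⟩ := (((hlim.eventually hmin).and
    (hlim.eventually (Metric.ball_mem_nhds x hr))).and hsmall |>.and
      self_mem_nhdsWithin).exists
  replace ht0 : 0 < t := ht0
  have hxb : x ∈ Metric.ball x r := Metric.mem_ball_self hr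
  have hmv := hCr.le_apply_sub_of_le_apply_fderiv
    Metric.isOpen_ball (convex_ball x r) (innerSL ℝ u) (t • p) (c := t * c)
    (fun w hw hwd => by
      have := (hball w hw).1 hwd
      simp only [Set.mem_ofPred_eq] at this
      rw [innerSL_apply_apply, map_smul, inner_smul_right]
      gcongr)
    hb (by simpa using hxb)
  rw [innerSL_apply_apply, sub_add_cancel] at hmv
  have hLip : ‖f x - f (x - t • p)‖ ≤ C * ‖p‖ * t := by
    have := hCr.dist_le_mul x hxb _ hb
    rw [dist_eq_norm, dist_eq_norm, sub_sub_cancel, norm_smul, Real.norm_of_nonneg ht0.le] at this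
    linarith
  have hexp : ‖f (x - t • p) - y‖ ^ 2 =
      ‖u‖ ^ 2 - 2 * inner ℝ u (f x - f (x - t • p)) + ‖f x - f (x - t • p)‖ ^ 2 := by
    rw [← norm_sub_sq_real]
    congr 2
    simp only [u]
    abel
  have h1 : ‖u‖ ^ 2 ≤ ‖f (x - t • p) - y‖ ^ 2 := by gcongr
  have h2 : ‖f x - f (x - t • p)‖ ^ 2 ≤ (C * ‖p‖ * t) ^ 2 := by gcongr
  nlinarith

end MaximalRank

/-! ### Proper local homeomorphisms as coverings -/

/-- A proper local homeomorphism from a connected nonempty space onto a simply connected,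
locally path-connected space is bijective. -/
theorem IsLocalHomeomorph.bijective_of_isProperMap {E X : Type*} [TopologicalSpace E]
    [TopologicalSpace X] [T2Space E] [T2Space X] [PreconnectedSpace E] [Nonempty E]
    [SimplyConnectedSpace X] [LocallyPathConnectedSpace X] {f : E → X}
    (hf : IsLocalHomeomorph f) (hproper : IsProperMap f) : Function.Bijective f := by
  have hfin (x : X) : (f ⁻¹' {x}).Finite := by
    refine (hproper.isCompact_preimage isCompact_singleton).finite ?_
    exact IsDiscrete.of_openPartialHomeomorph f subset_rfl fun e _ =>
      (hf e).imp fun φ hφ => ⟨hφ.1, hφ.2.symm⟩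
  have hcov : IsCoveringMap f := isCoveringMap_iff_isCoveringMapOn_univ.2 <|
    hproper.isClosedMap.isCoveringMapOn_of_isLocalHomeomorphOn (fun x _ => hfin x)
      (isLocalHomeomorph_iff_isLocalHomeomorphOn_univ.1 hf)
  obtain ⟨e₀⟩ := ‹Nonempty E›
  -- Simple connectedness lifts the identity to a section `g`; uniqueness of lifts on connected `E`
  -- makes `g ∘ f` the identity.
  obtain ⟨g, ⟨hg₀, hg⟩, -⟩ :=
    hcov.existsUnique_continuousMap_lifts (ContinuousMap.id X) (f e₀) e₀ rfl
  have hright : Function.RightInverse g f := congrFun hg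
  have hleft : g ∘ f = id := hcov.eq_of_comp_eq (g.continuous.comp hf.continuous) continuous_id
    (funext fun e => hright (f e)) e₀ hg₀
  exact ⟨Function.LeftInverse.injective (congrFun hleft), hright.surjective⟩

/-! ### Openness, properness and the global inverse -/

section Global

variable {n : ℕ} {f : EuclideanSpace ℝ (Fin n) → EuclideanSpace ℝ (Fin n)}

/-- A locally Lipschitz map with nonsingular generalized Jacobians is open. -/
theorem LocallyLipschitz.isOpenMap_of_isOfMaximalRank (hf : LocallyLipschitz f)
    (hrank : ∀ x, IsOfMaximalRank (clarkeJacobian f x)) : IsOpenMap f := by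
  rw [isOpenMap_iff_nhds_le]
  intro x U hU
  obtain ⟨δ, hδ, r, hr, hexp⟩ := hf.exists_mul_norm_sub_le (hrank x)
  obtain ⟨ε, hε, hεU⟩ := Metric.mem_nhds_iff.1 hU
  obtain ⟨ρ, hρ0, hρ⟩ := exists_between (lt_min hr hε)
  have hρr : ρ < r := hρ.trans_le (min_le_left _ _)
  have hρε : ρ < ε := hρ.trans_le (min_le_right _ _)
  refine Metric.mem_nhds_iff.2 ⟨δ * ρ / 2, by positivity, fun y hy => ?_⟩
  rw [Metric.mem_ball, dist_comm, dist_eq_norm] at hy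
  obtain ⟨z, hz, hzmin⟩ := (isCompact_closedBall x ρ).exists_isMinOn
    ⟨x, Metric.mem_closedBall_self hρ0.le⟩
    (f := fun z => ‖f z - y‖) (hf.continuous.sub continuous_const).norm.continuousOn
  have hzx : ‖f z - y‖ ≤ ‖f x - y‖ := hzmin (Metric.mem_closedBall_self hρ0.le)
  -- The minimizer is interior: `‖f z - f x‖ ≤ 2‖f x - y‖ < δρ`, whence the radius `δ * ρ / 2`.
  have hzρ : dist z x < ρ := by
    have h1 := hexp z (Metric.closedBall_subset_ball hρr hz) x (Metric.mem_ball_self hr)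
    have h2 : ‖f z - f x‖ ≤ ‖f z - y‖ + ‖f x - y‖ := by
      rw [norm_sub_rev (f x) y]; exact norm_sub_le_norm_sub_add_norm_sub _ _ _
    rw [dist_eq_norm]
    refine lt_of_mul_lt_mul_left (?_ : δ * ‖z - x‖ < δ * ρ) hδ.le
    linarith
  have hfz : f z = y := hf.eq_of_isLocalMin_norm_sub (hrank z)
    (hzmin.isLocalMin (Metric.closedBall_mem_nhds_of_mem hzρ))
  exact hfz ▸ hεU (hzρ.trans hρε)

theorem LocallyLipschitz.isLocalHomeomorph_of_isOfMaximalRank (hf : LocallyLipschitz f)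
    (hrank : ∀ x, IsOfMaximalRank (clarkeJacobian f x)) : IsLocalHomeomorph f := by
  rw [isLocalHomeomorph_iff_isOpenEmbedding_restrict]
  intro x
  obtain ⟨δ, hδ, r, hr, hexp⟩ := hf.exists_mul_norm_sub_le (hrank x)
  refine ⟨Metric.ball x r, Metric.ball_mem_nhds x hr,
    .of_continuous_injective_isOpenMap (hf.continuous.comp continuous_subtype_val) ?_
      ((hf.isOpenMap_of_isOfMaximalRank hrank).domRestrict Metric.isOpen_ball)⟩
  rintro ⟨a, ha⟩ ⟨b, hb⟩ (hab : f a = f b)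
  have h := hexp a ha b hb
  rw [hab, sub_self, norm_zero] at h
  have h0 : ‖a - b‖ ≤ 0 := nonpos_of_mul_nonpos_right h hδ
  exact Subtype.ext (sub_eq_zero.1 (norm_le_zero_iff.1 h0))

theorem isProperMap_of_isCoerciveFunctional (hf : Continuous f)
    (hcoercive : IsCoerciveFunctional fun x => (1 / 2 : ℝ) * ‖f x - 0‖ ^ 2) :
    IsProperMap f := by
  refine isProperMap_iff_tendsto_cocompact.2 ⟨hf, ?_⟩
  rw [← Metric.cobounded_eq_cocompact,
    ← tendsto_norm_atTop_iff_cobounded, ← comap_norm_atTop]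
  refine tendsto_atTop.2 fun b => ?_
  filter_upwards [hcoercive.eventually_ge_atTop ((1 / 2 : ℝ) * b ^ 2)] with x hx
  rw [sub_zero] at hx
  exact (abs_le_of_sq_le_sq' (by linarith) (norm_nonneg _)).2

end Global

theorem theorem6 {n : ℕ} (f : EuclideanSpace ℝ (Fin n) → EuclideanSpace ℝ (Fin n))
    (hf : LocallyLipschitz f)
    (hcoercive : ∀ y : EuclideanSpace ℝ (Fin n),
      IsCoerciveFunctional (fun x => (1 / 2 : ℝ) * ‖f x - y‖ ^ 2))
    (hrank : ∀ x : EuclideanSpace ℝ (Fin n), IsOfMaximalRank (clarkeJacobian f x)) :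
    ∃ h : EuclideanSpace ℝ (Fin n) ≃ₜ EuclideanSpace ℝ (Fin n),
      (∀ x, h x = f x) ∧ LocallyLipschitz h.symm := by
  have hbij : Function.Bijective f :=
    (hf.isLocalHomeomorph_of_isOfMaximalRank hrank).bijective_of_isProperMap
      (isProperMap_of_isCoerciveFunctional hf.continuous (hcoercive 0))
  let h : EuclideanSpace ℝ (Fin n) ≃ₜ EuclideanSpace ℝ (Fin n) :=
    (Equiv.ofBijective f hbij).toHomeomorphOfContinuousOpen hf.continuous
      (hf.isOpenMap_of_isOfMaximalRank hrank)
  have hh (x) : h x = f x := rfl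
  refine ⟨h, hh, fun y => ?_⟩
  -- Expansion by `δ` near the preimage of `y` is a Lipschitz bound `δ⁻¹` for the inverse near `y`.
  obtain ⟨δ, hδ, r, hr, hexp⟩ := hf.exists_mul_norm_sub_le (hrank (h.symm y))
  refine ⟨NNReal.mk δ⁻¹ (by positivity), h.symm ⁻¹' Metric.ball (h.symm y) r,
    h.symm.continuous.continuousAt (Metric.ball_mem_nhds _ hr),
    LipschitzOnWith.of_dist_le_mul fun a ha b hb => ?_⟩
  have := hexp _ ha _ hb
  rw [← hh, ← hh, h.apply_symm_apply, h.apply_symm_apply, ← dist_eq_norm, ← dist_eq_norm] at this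
  rw [NNReal.coe_mk, inv_mul_eq_div, le_div_iff₀ hδ]
  linarith
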